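/- Let $J,R,Q\in\mathbb R^{n\times n}$ and $B\in\mathbb R^{n\times m}$, where $J$ is skew-symmetric, $R$ is symmetric positive semidefinite, $Q$ is symmetric positive definite and $B$ has full rank $m\le n$. Put $A=(J-R)Q$ and consider the port-Hamiltonian control system $\dot x=Ax+Bu$. For $\lambda\in\mathbb C$ let $$N_\lambda(A)=\operatorname{span}\{\operatorname{Re}z,\ \operatorname{Im}z : z\in\mathbb C^n,\ Az=\lambda z\}\subset\mathbb R^n .$$ Let $M_1=\operatorname{span}\{N_{i\alpha}(A):\alpha\in\mathbb R,\ i\alpha\in\sigma(A)\}$ (the conservative subspace) and let $M_2$ (the dissipative subspace) be the orthogonal complement of $M_1$ with respect to the inner product $\langle Q\,\cdot\,,\cdot\rangle$. Let $P_1,P_2$ be the projections onto $M_1$, $M_2$ belonging to the decomposition $\mathbb R^n=M_1\oplus M_2$, and set $J_k=P_kJQ|_{M_k}$, $B_k=P_kB$ for $k=1,2$, and $R_2=P_2RQ|_{M_2}$. Let $\mathbb U\subset\mathbb R^m$ be compact with $0\in\operatorname{int}(\mathbb U)$. Let $L^1(0,T;\mathbb U)$ be the set of Lebesgue integrable functions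 on $(0,T)$ with values in $\mathbb U$. Solutions of differential equations on $[0,T]$ are absolutely continuous functions that satisfy the equation almost everywhere. Assume that the system is controllable, i.e. $\operatorname{rank}(B,AB,\ldots,A^{n-1}B)=n$. Then: (i) For all $x_1^0,x_1^\star\in M_1$ there exist a time $T>0$ and a control $u\in L^1(0,T;\mathbb U)$ such that the solution of $\dot x_1=J_1x_1+B_1u$, $x_1(0)=x_1^0$, satisfies $x_1(T)=x_1^\star$. (ii) For every $x_2^0\in M_2$, the set of all $x_2(T)\in M_2$, where $T\ge 0$, $u\in L^1(0,T;\mathbb U)$ and $x_2$ is the solution of $\dot x_2=(J_2-R_2)x_2+B_2u$, $x_2(0)=x_2^0$, on $[0,T]$, is bounded. -/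

import Mathlib

/-- A linear port-Hamiltonian system `x' = (J - R) Q x + B u` with `n` states and `m` inputs. -/
structure PHSystem (n m : ℕ) where
  J : Matrix (Fin n) (Fin n) ℝ
  R : Matrix (Fin n) (Fin n) ℝ
  Q : Matrix (Fin n) (Fin n) ℝ
  B : Matrix (Fin n) (Fin m) ℝ
  J_skew : J.transpose = -J
  R_posSemidef : R.PosSemidef
  Q_posDef : Q.PosDef
  B_rank : B.rank = m

/-- `N_μ(A)`: the real span of all `Re z`, `Im z`, where `z ∈ ℂⁿ` satisfies `A z = μ z`. -/
def realEigenspan {n : ℕ} (A : Matrix (Fin n) (Fin n) ℝ) (μ : ℂ) :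
    Submodule ℝ (Fin n → ℝ) :=
  Submodule.span ℝ {v | ∃ z : Fin n → ℂ, (A.map Complex.ofReal).mulVec z = μ • z ∧
    (v = (fun i => (z i).re) ∨ v = (fun i => (z i).im))}

namespace PHSystem

variable {n m : ℕ} (S : PHSystem n m)

/-- The system matrix `A = (J - R) Q`. -/
def A : Matrix (Fin n) (Fin n) ℝ := (S.J - S.R) * S.Q

/-- The Kalman matrix `(B, A B, …, A ^ (n - 1) B)`; its columns are indexed by pairs `(k, j)`. -/
def kalmanMatrix : Matrix (Fin n) (Fin n × Fin m) ℝ :=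
  Matrix.of fun i p => (S.A ^ (p.1 : ℕ) * S.B) i p.2

/-- Controllability: the Kalman matrix has rank `n`. -/
def IsControllable : Prop := S.kalmanMatrix.rank = n

/-- The conservative subspace `M₁`, spanned by all `N_{iα}(A)` with `α` real, `iα ∈ σ(A)`. -/
def M₁ : Submodule ℝ (Fin n → ℝ) :=
  ⨆ α ∈ {α : ℝ | (α : ℂ) * Complex.I ∈ spectrum ℂ (S.A.map Complex.ofReal)},
    realEigenspan S.A ((α : ℂ) * Complex.I)

/-- The dissipative subspace `M₂`, the orthogonal complement of `M₁` for `⟨Q ·, ·⟩`. -/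
def M₂ : Submodule ℝ (Fin n → ℝ) :=
  (Matrix.toBilin' S.Q).orthogonal S.M₁

theorem isCompl : IsCompl S.M₁ S.M₂ := by
  have hsymm : S.Q.transpose = S.Q := by
    simpa [Matrix.IsHermitian, Matrix.conjTranspose_eq_transpose_of_trivial]
      using S.Q_posDef.isHermitian
  have hrefl : (Matrix.toBilin' S.Q).IsRefl := by
    intro x y h
    rw [Matrix.toBilin'_apply'] at h ⊢
    rw [dotProduct_comm] at h
    rw [Matrix.dotProduct_mulVec, ← Matrix.mulVec_transpose, hsymm]
    exact h
  have hpos : ∀ x : Fin n → ℝ, Matrix.toBilin' S.Q x x = 0 → x = 0 := by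
    intro x hx
    by_contra hne
    have := S.Q_posDef.dotProduct_mulVec_pos hne
    rw [Matrix.toBilin'_apply'] at hx
    simp [hx] at this
  refine (LinearMap.BilinForm.isCompl_orthogonal_iff_disjoint hrefl).2 ?_
  rw [Submodule.disjoint_def]
  intro x hx hx'
  exact hpos x (hx' x hx)

/-- The projection onto `M₁` along `M₂`. -/
noncomputable def P₁ : (Fin n → ℝ) →ₗ[ℝ] S.M₁ := S.M₁.projectionOnto S.M₂ S.isCompl

/-- The projection onto `M₂` along `M₁`. -/
noncomputable def P₂ : (Fin n → ℝ) →ₗ[ℝ] S.M₂ := S.M₂.projectionOnto S.M₁ S.isCompl.symm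

/-- The diagonal block of `J Q` on `M₁`. -/
noncomputable def J₁ : S.M₁ →ₗ[ℝ] S.M₁ := S.P₁ ∘ₗ (S.J * S.Q).mulVecLin ∘ₗ S.M₁.subtype

/-- The diagonal block of `J Q` on `M₂`. -/
noncomputable def J₂ : S.M₂ →ₗ[ℝ] S.M₂ := S.P₂ ∘ₗ (S.J * S.Q).mulVecLin ∘ₗ S.M₂.subtype

/-- The diagonal block of `R Q` on `M₂`. -/
noncomputable def R₂ : S.M₂ →ₗ[ℝ] S.M₂ := S.P₂ ∘ₗ (S.R * S.Q).mulVecLin ∘ₗ S.M₂.subtype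

/-- The `M₁` component of the input map. -/
noncomputable def B₁ : (Fin m → ℝ) →ₗ[ℝ] S.M₁ := S.P₁ ∘ₗ S.B.mulVecLin

/-- The `M₂` component of the input map. -/
noncomputable def B₂ : (Fin m → ℝ) →ₗ[ℝ] S.M₂ := S.P₂ ∘ₗ S.B.mulVecLin

end PHSystem

/-- `u ∈ L¹(0, T; U)`: `u` is Lebesgue integrable on `(0, T)` with values in `U` almost
everywhere there. -/
def IsAdmissibleControl {m : ℕ} (U : Set (Fin m → ℝ)) (T : ℝ) (u : ℝ → Fin m → ℝ) : Prop :=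
  MeasureTheory.IntegrableOn u (Set.Ioo 0 T) ∧
    ∀ᵐ t ∂(MeasureTheory.volume.restrict (Set.Ioo 0 T)), u t ∈ U

/-- `x` is a solution of `x' = F x + G u` on `[0, T]`: it is absolutely continuous (the continuous
representative of a `W^{1,1}` function) and satisfies the equation almost everywhere. -/
def IsSolution {E : Type*} [NormedAddCommGroup E] [NormedSpace ℝ E] {m : ℕ}
    (F : E →ₗ[ℝ] E) (G : (Fin m → ℝ) →ₗ[ℝ] E) (T : ℝ) (u : ℝ → Fin m → ℝ) (x : ℝ → E) : Prop :=
  AbsolutelyContinuousOnInterval x 0 T ∧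
    ∀ᵐ t ∂(MeasureTheory.volume.restrict (Set.Ioo 0 T)), HasDerivAt x (F (x t) + G (u t)) t

/-- The control `u` steers `a` to `b` at time `T` under `x' = F x + G u`. -/
def Steers {E : Type*} [NormedAddCommGroup E] [NormedSpace ℝ E] {m : ℕ}
    (F : E →ₗ[ℝ] E) (G : (Fin m → ℝ) →ₗ[ℝ] E) (T : ℝ) (u : ℝ → Fin m → ℝ) (a b : E) : Prop :=
  ∃ x : ℝ → E, IsSolution F G T u x ∧ x 0 = a ∧ x T = b

/-- The states that can be reached from `a` at some time `T ≥ 0` under `x' = F x + G u` with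
controls `u ∈ L¹(0, T; U)`. -/
def reachableSet {E : Type*} [NormedAddCommGroup E] [NormedSpace ℝ E] {m : ℕ}
    (F : E →ₗ[ℝ] E) (G : (Fin m → ℝ) →ₗ[ℝ] E) (U : Set (Fin m → ℝ)) (a : E) : Set E :=
  {b | ∃ T : ℝ, 0 ≤ T ∧ ∃ u : ℝ → Fin m → ℝ, IsAdmissibleControl U T u ∧ Steers F G T u a b}

/-!
The energy form `⟨Q x, y⟩` makes `J Q` skew and `R Q` symmetric and nonnegative. The energy balance
of an eigenvector of `A = (J - R) Q` for an imaginary eigenvalue shows that `R Q` kills its real and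
imaginary parts. Hence `R Q = 0` on `M₁`, both `M₁` and `M₂` are invariant under `A`, and the two
block systems are the restrictions of `A`: skew on `M₁`, dissipative on `M₂`.

*Steering on `M₁`.* Controllability passes to `M₁` (`PHSystem.observable_J₁`), so the Gramian
`W_T = ∫₀ᵀ e^{-sJ} G G* e^{sJ} ds`, with `J`, `G` the blocks on `M₁`, is positive definite for
`T = 1` (`form_gramian_pos`). Because `e^{tJ}` preserves the energy, `W_T` grows linearly in `T`
(`exists_gramian_lower_bound`). The control `u(s) = G* e^{sJ} W_T⁻¹ (e^{-TJ} b - a)` steers `a`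
to `b` in time `T` and has size `O(1 / T)`, so for large `T` its values lie in any given
neighbourhood of `0` (`exists_steers_of_skew`).

*Boundedness on `M₂`.* A nonzero `A`-invariant subspace of `M₂` on which `R Q` vanishes would
contain the parts of an eigenvector for an imaginary eigenvalue, which lie in `M₁`. So the
dissipation is observable on `M₂` (`PHSystem.observable_R₂`) and the energy strictly decreases over
unit time (`form_flow_one_lt`). The average of the energy along the flow over `[0, 1]` is then a
strict quadratic Lyapunov function (`averagedForm_lyapunov`), and a Grönwall argument for absolutely
continuous functions bounds all trajectories with bounded controls
(`isBounded_reachableSet_of_dissipative`).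
-/

open Set MeasureTheory Filter
open scoped Topology

/-! ### The flow of a linear differential equation -/

section Flow

variable {E : Type*} [NormedAddCommGroup E] [NormedSpace ℝ E]

/-- The flow `t ↦ exp (t F)` of the linear differential equation `x' = F x`. -/
noncomputable def flow (F : E →L[ℝ] E) (t : ℝ) : E →L[ℝ] E := NormedSpace.exp (t • F)

@[simp]
theorem flow_zero (F : E →L[ℝ] E) : flow F 0 = 1 := by
  simp [flow]

variable [CompleteSpace E]

theorem flow_add (F : E →L[ℝ] E) (s t : ℝ) : flow F (s + t) = flow F s * flow F t := by
  unfold flow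
  rw [add_smul]
  refine NormedSpace.exp_add_of_commute_of_mem_ball (𝕂 := ℝ)
    (((Commute.refl F).smul_left s).smul_right t) ?_ ?_ <;>
  exact (NormedSpace.expSeries_radius_eq_top ℝ (E →L[ℝ] E)).symm ▸ edist_lt_top _ _

theorem flow_add_apply (F : E →L[ℝ] E) (s t : ℝ) (x : E) :
    flow F (s + t) x = flow F s (flow F t x) := by
  rw [flow_add]; rfl

@[simp]
theorem flow_apply_flow_neg (F : E →L[ℝ] E) (t : ℝ) (x : E) : flow F t (flow F (-t) x) = x := by
  rw [← flow_add_apply]; simp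

@[simp]
theorem flow_neg_apply_flow (F : E →L[ℝ] E) (t : ℝ) (x : E) : flow F (-t) (flow F t x) = x := by
  rw [← flow_add_apply]; simp

theorem hasDerivAt_flow (F : E →L[ℝ] E) (t : ℝ) : HasDerivAt (flow F) (F * flow F t) t :=
  hasDerivAt_exp_smul_const' F t

theorem hasDerivAt_flow_apply (F : E →L[ℝ] E) (x : E) (t : ℝ) :
    HasDerivAt (fun s => flow F s x) (F (flow F t x)) t := by
  simpa using (hasDerivAt_flow F t).clm_apply (hasDerivAt_const t x)

theorem continuous_flow (F : E →L[ℝ] E) : Continuous (flow F) :=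
  continuous_iff_continuousAt.2 fun t => (hasDerivAt_flow F t).continuousAt

theorem continuous_flow_apply (F : E →L[ℝ] E) (x : E) : Continuous fun t => flow F t x :=
  (continuous_flow F).clm_apply continuous_const

/-- The output `L (exp (t F) x)` of an observable pair `(L, F)` determines the state: it can vanish
on a time interval only if `x = 0`. All its time derivatives `L (F ^ k (exp (t F) x))` then
vanish there as well. -/
theorem eq_zero_of_flow_output_eq_zero {G : Type*} [NormedAddCommGroup G] [NormedSpace ℝ G]
    (F : E →L[ℝ] E) (L : E →L[ℝ] G) (hobs : ∀ y, (∀ k : ℕ, L ((F ^ k) y) = 0) → y = 0) {x : E}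
    (hx : ∀ t ∈ Ioo (0 : ℝ) 1, L (flow F t x) = 0) : x = 0 := by
  have key : ∀ k : ℕ, ∀ t ∈ Ioo (0 : ℝ) 1, L ((F ^ k) (flow F t x)) = 0 := by
    intro k
    induction k with
    | zero => simpa using hx
    | succ k ih =>
      intro t ht
      have h1 : HasDerivAt (fun s => L ((F ^ k) (flow F s x))) (L ((F ^ k) (F (flow F t x)))) t :=
        (L.comp (F ^ k)).hasFDerivAt.comp_hasDerivAt t (hasDerivAt_flow_apply F x t)
      have h2 : HasDerivAt (fun s => L ((F ^ k) (flow F s x))) 0 t :=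
        (hasDerivAt_const t (0 : G)).congr_of_eventuallyEq
          (by filter_upwards [isOpen_Ioo.mem_nhds ht] with s hs using ih s hs)
      rw [pow_succ]
      exact h1.unique h2
  have h0 : flow F (1 / 2) x = 0 :=
    hobs _ fun k => key k _ ⟨by norm_num, by norm_num⟩
  rw [← flow_neg_apply_flow F (1 / 2) x, h0, map_zero]

end Flow

/-! ### Bilinear forms and absolutely continuous curves -/

section Forms

variable {E : Type*} [NormedAddCommGroup E] [NormedSpace ℝ E]

/-- A positive definite form on a finite-dimensional space is coercive. -/
theorem exists_coercive_of_pos [FiniteDimensional ℝ E] {p : E → ℝ} (hp : Continuous p)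
    (hsmul : ∀ (a : ℝ) x, p (a • x) = a ^ 2 * p x) (hpos : ∀ x, x ≠ 0 → 0 < p x) :
    ∃ c : ℝ, 0 < c ∧ ∀ x, c * ‖x‖ ^ 2 ≤ p x := by
  have : ProperSpace E := FiniteDimensional.proper_real E
  have h0 : p 0 = 0 := by
    have h := hsmul 0 0
    rwa [zero_smul, zero_pow two_ne_zero, zero_mul] at h
  rcases (Metric.sphere (0 : E) 1).eq_empty_or_nonempty with he | hne
  · refine ⟨1, one_pos, fun x => ?_⟩
    have hx : x = 0 := by
      by_contra hx
      have : ‖x‖⁻¹ • x ∈ Metric.sphere (0 : E) 1 := by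
        simp [norm_smul, hx]
      simp [he] at this
    simp [hx, h0]
  · obtain ⟨z, hz, hmin⟩ := (isCompact_sphere (0 : E) 1).exists_isMinOn hne hp.continuousOn
    have hz0 : z ≠ 0 := by
      rintro rfl
      simp at hz
    refine ⟨p z, hpos z hz0, fun x => ?_⟩
    rcases eq_or_ne x 0 with rfl | hx
    · simp [h0]
    · have hmem : ‖x‖⁻¹ • x ∈ Metric.sphere (0 : E) 1 := by
        simp [norm_smul, hx]
      have h1 : p z ≤ p (‖x‖⁻¹ • x) := hmin hmem
      rw [hsmul] at h1
      have hn : 0 < ‖x‖ := norm_pos_iff.2 hx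
      calc p z * ‖x‖ ^ 2 ≤ (‖x‖⁻¹ ^ 2 * p x) * ‖x‖ ^ 2 := by gcongr
        _ = p x := by field_simp

theorem exists_coercive_form [FiniteDimensional ℝ E] (q : E →L[ℝ] E →L[ℝ] ℝ)
    (hpos : ∀ x, x ≠ 0 → 0 < q x x) : ∃ c : ℝ, 0 < c ∧ ∀ x, c * ‖x‖ ^ 2 ≤ q x x := by
  refine exists_coercive_of_pos (p := fun x => q x x) (by fun_prop) (fun a x => ?_) hpos
  simp only [map_smul, smul_apply, smul_eq_mul]
  ring

theorem form_apply_le (q : E →L[ℝ] E →L[ℝ] ℝ) (x y : E) : q x y ≤ ‖q‖ * ‖x‖ * ‖y‖ :=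
  (Real.le_norm_self _).trans (q.le_opNorm₂ x y)

theorem hasDerivAt_form (q : E →L[ℝ] E →L[ℝ] ℝ) {f g : ℝ → E} {f' g' : E} {t : ℝ}
    (hf : HasDerivAt f f' t) (hg : HasDerivAt g g' t) :
    HasDerivAt (fun s => q (f s) (g s)) (q f' (g t) + q (f t) g') t :=
  (q.hasFDerivAt.comp_hasDerivAt t hf).clm_apply hg

theorem AbsolutelyContinuousOnInterval.lipschitzOnWith_comp {X Y : Type*} [PseudoMetricSpace X]
    [PseudoMetricSpace Y] {f : ℝ → X} {a b : ℝ} (hf : AbsolutelyContinuousOnInterval f a b)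
    {g : X → Y} {K : NNReal} {s : Set X} (hg : LipschitzOnWith K g s)
    (hs : MapsTo f (uIcc a b) s) : AbsolutelyContinuousOnInterval (g ∘ f) a b := by
  rw [absolutelyContinuousOnInterval_iff] at hf ⊢
  intro ε hε
  obtain ⟨δ, hδ, h⟩ := hf (ε / (K + 1)) (by positivity)
  refine ⟨δ, hδ, fun I hI hlen => ?_⟩
  calc ∑ i ∈ Finset.range I.1, dist ((g ∘ f) (I.2 i).1) ((g ∘ f) (I.2 i).2)
      ≤ ∑ i ∈ Finset.range I.1, K * dist (f (I.2 i).1) (f (I.2 i).2) :=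
        Finset.sum_le_sum fun i hi =>
          hg.dist_le_mul _ (hs (hI.1 i hi).1) _ (hs (hI.1 i hi).2)
    _ = K * ∑ i ∈ Finset.range I.1, dist (f (I.2 i).1) (f (I.2 i).2) := by rw [Finset.mul_sum]
    _ ≤ K * (ε / (K + 1)) := by gcongr; exact (h I hI hlen).le
    _ < (K + 1) * (ε / (K + 1)) := by gcongr; linarith
    _ = ε := by field_simp

theorem lipschitzOnWith_form_self (q : E →L[ℝ] E →L[ℝ] ℝ) {C : ℝ} (hC : 0 ≤ C) :
    LipschitzOnWith (Real.toNNReal (2 * ‖q‖ * C)) (fun x => q x x) (Metric.closedBall 0 C) := by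
  refine LipschitzOnWith.of_dist_le_mul fun x hx y hy => ?_
  rw [mem_closedBall_zero_iff] at hx hy
  rw [Real.coe_toNNReal _ (by positivity), dist_eq_norm, dist_eq_norm]
  have h : q x x - q y y = q x (x - y) + q (x - y) y := by
    rw [map_sub, map_sub, sub_apply]
    ring
  rw [h]
  calc ‖q x (x - y) + q (x - y) y‖ ≤ ‖q x (x - y)‖ + ‖q (x - y) y‖ := norm_add_le _ _
    _ ≤ ‖q‖ * ‖x‖ * ‖x - y‖ + ‖q‖ * ‖x - y‖ * ‖y‖ :=
      add_le_add (q.le_opNorm₂ _ _) (q.le_opNorm₂ _ _)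
    _ ≤ ‖q‖ * C * ‖x - y‖ + ‖q‖ * ‖x - y‖ * C := by gcongr
    _ = 2 * ‖q‖ * C * ‖x - y‖ := by ring

/-- A quadratic form is Lipschitz on bounded sets, so it preserves absolute continuity. -/
theorem AbsolutelyContinuousOnInterval.form_self (q : E →L[ℝ] E →L[ℝ] ℝ) {f : ℝ → E} {a b : ℝ}
    (hf : AbsolutelyContinuousOnInterval f a b) :
    AbsolutelyContinuousOnInterval (fun t => q (f t) (f t)) a b := by
  obtain ⟨C, hC⟩ := hf.exists_bound
  have hC0 : 0 ≤ C := (norm_nonneg _).trans (hC a left_mem_uIcc)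
  have hm : MapsTo f (uIcc a b) (Metric.closedBall 0 C) := fun t ht =>
    mem_closedBall_zero_iff.2 (hC t ht)
  have h := hf.lipschitzOnWith_comp (lipschitzOnWith_form_self q hC0) hm
  exact h

end Forms

/-! ### Steering conservative systems with small controls -/

section Skew

variable {E : Type*} [NormedAddCommGroup E] [NormedSpace ℝ E]

/-- The adjoint of an input map `G : ℝᵐ → E`, with respect to the form `q` on `E` and the dot
product on `ℝᵐ`. -/
noncomputable def inputAdjoint {m : ℕ} (q : E →L[ℝ] E →L[ℝ] ℝ) (G : (Fin m → ℝ) →L[ℝ] E) :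
    E →L[ℝ] (Fin m → ℝ) :=
  ContinuousLinearMap.pi fun j => q (G (Pi.single j 1))

theorem form_input_eq_dotProduct {m : ℕ} (q : E →L[ℝ] E →L[ℝ] ℝ) (G : (Fin m → ℝ) →L[ℝ] E)
    (u : Fin m → ℝ) (y : E) : q (G u) y = u ⬝ᵥ inputAdjoint q G y := by
  conv_lhs => rw [pi_eq_sum_univ' u]
  simp [dotProduct, inputAdjoint, map_sum]

variable [CompleteSpace E] {q : E →L[ℝ] E →L[ℝ] ℝ} {J : E →L[ℝ] E}

theorem form_flow_flow_of_skew (hskew : ∀ x y, q (J x) y = -q x (J y)) (t : ℝ) (x y : E) :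
    q (flow J t x) (flow J t y) = q x y := by
  have hd : ∀ s, HasDerivAt (fun s => q (flow J s x) (flow J s y)) 0 s := fun s => by
    have h := hasDerivAt_form q (hasDerivAt_flow_apply J x s) (hasDerivAt_flow_apply J y s)
    rwa [hskew, neg_add_cancel] at h
  have h := is_const_of_deriv_eq_zero (fun s => (hd s).differentiableAt) (fun s => (hd s).deriv) t 0
  simpa using h

theorem form_flow_neg_of_skew (hskew : ∀ x y, q (J x) y = -q x (J y)) (t : ℝ) (x y : E) :
    q (flow J (-t) x) y = q x (flow J t y) := by
  rw [← form_flow_flow_of_skew hskew t (flow J (-t) x) y, flow_apply_flow_neg]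

theorem exists_norm_flow_le_of_skew [FiniteDimensional ℝ E] (hpos : ∀ x, x ≠ 0 → 0 < q x x)
    (hskew : ∀ x y, q (J x) y = -q x (J y)) :
    ∃ C : ℝ, 0 < C ∧ ∀ t x, ‖flow J t x‖ ≤ C * ‖x‖ := by
  obtain ⟨c, hc, hq⟩ := exists_coercive_form q hpos
  refine ⟨Real.sqrt ((‖q‖ + 1) / c), by positivity, fun t x => ?_⟩
  refine abs_le_of_sq_le_sq' ?_ (by positivity) |>.2
  rw [mul_pow, Real.sq_sqrt (by positivity), div_mul_eq_mul_div, le_div_iff₀ hc]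
  calc ‖flow J t x‖ ^ 2 * c = c * ‖flow J t x‖ ^ 2 := mul_comm _ _
    _ ≤ q x x := (hq _).trans_eq (form_flow_flow_of_skew hskew t x x)
    _ ≤ ‖q‖ * ‖x‖ * ‖x‖ := form_apply_le q x x
    _ ≤ (‖q‖ + 1) * ‖x‖ ^ 2 := by nlinarith [sq_nonneg ‖x‖]

variable {m : ℕ}

/-- The integrand of the controllability Gramian: `e^{-sJ} G G* e^{sJ}`. -/
noncomputable def gramianIntegrand (q : E →L[ℝ] E →L[ℝ] ℝ) (J : E →L[ℝ] E)
    (G : (Fin m → ℝ) →L[ℝ] E) (s : ℝ) : E →L[ℝ] E :=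
  (flow J (-s)).comp ((G.comp (inputAdjoint q G)).comp (flow J s))

/-- The controllability Gramian `∫₀ᵀ e^{-sJ} G G* e^{sJ} ds`. The operator `e^{-sJ}` is the adjoint
of `e^{sJ}` when `J` is skew with respect to `q`. -/
noncomputable def gramian (q : E →L[ℝ] E →L[ℝ] ℝ) (J : E →L[ℝ] E)
    (G : (Fin m → ℝ) →L[ℝ] E) (T : ℝ) : E →L[ℝ] E :=
  ∫ s in (0 : ℝ)..T, gramianIntegrand q J G s

variable {G : (Fin m → ℝ) →L[ℝ] E}

theorem continuous_gramianIntegrand : Continuous (gramianIntegrand q J G) :=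
  ((continuous_flow J).comp continuous_neg).clm_comp
    (continuous_const.clm_comp (continuous_flow J))

theorem gramian_apply (T : ℝ) (v : E) :
    gramian q J G T v = ∫ s in (0 : ℝ)..T, gramianIntegrand q J G s v :=
  ContinuousLinearMap.intervalIntegral_apply
    (continuous_gramianIntegrand.intervalIntegrable 0 T) v

theorem continuous_outputEnergy (v : E) : Continuous fun s =>
    inputAdjoint q G (flow J s v) ⬝ᵥ inputAdjoint q G (flow J s v) := by
  have h : Continuous fun s => inputAdjoint q G (flow J s v) :=
    (inputAdjoint q G).continuous.comp (continuous_flow_apply J v)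
  exact h.dotProduct h

/-- The quadratic form of the Gramian is the energy of the output `G* e^{sJ} v`. -/
theorem form_gramian_apply (hskew : ∀ x y, q (J x) y = -q x (J y)) (T : ℝ) (v : E) :
    q (gramian q J G T v) v = ∫ s in (0 : ℝ)..T,
      inputAdjoint q G (flow J s v) ⬝ᵥ inputAdjoint q G (flow J s v) := by
  have hint : IntervalIntegrable (fun s => gramianIntegrand q J G s v) volume 0 T :=
    (continuous_gramianIntegrand.clm_apply continuous_const).intervalIntegrable 0 T
  have h := (q.flip v).intervalIntegral_comp_comm hint
  rw [gramian_apply, ← ContinuousLinearMap.flip_apply, ← h]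
  refine intervalIntegral.integral_congr fun s _ => ?_
  simp only [ContinuousLinearMap.flip_apply, gramianIntegrand, ContinuousLinearMap.comp_apply]
  rw [form_flow_neg_of_skew hskew, form_input_eq_dotProduct]

theorem form_gramian_pos (hskew : ∀ x y, q (J x) y = -q x (J y))
    (hobs : ∀ y, (∀ (k : ℕ) u, q (G u) ((J ^ k) y) = 0) → y = 0) {v : E} (hv : v ≠ 0) :
    0 < q (gramian q J G 1 v) v := by
  have hnn : ∀ s, 0 ≤ inputAdjoint q G (flow J s v) ⬝ᵥ inputAdjoint q G (flow J s v) :=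
    fun s => Finset.sum_nonneg fun j _ => mul_self_nonneg _
  rw [form_gramian_apply hskew]
  refine intervalIntegral.integral_pos one_pos (continuous_outputEnergy v).continuousOn
    (fun s _ => hnn s) ?_
  by_contra! hcon
  refine hv (eq_zero_of_flow_output_eq_zero J (inputAdjoint q G) (fun y hy => hobs y ?_) ?_)
  · intro k u
    rw [form_input_eq_dotProduct, hy k, dotProduct_zero]
  · intro s hs
    exact dotProduct_self_eq_zero.1
      ((hcon s ⟨hs.1.le, hs.2.le⟩).antisymm (hnn s))

theorem form_gramian_succ (hskew : ∀ x y, q (J x) y = -q x (J y)) (k : ℕ) (v : E) :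
    q (gramian q J G (k + 1 : ℕ) v) v =
      q (gramian q J G k v) v + q (gramian q J G 1 (flow J k v)) (flow J k v) := by
  have hc := continuous_outputEnergy (q := q) (J := J) (G := G) v
  rw [form_gramian_apply hskew, form_gramian_apply hskew, form_gramian_apply hskew,
    ← intervalIntegral.integral_add_adjacent_intervals
      (hc.intervalIntegrable 0 (k : ℝ)) (hc.intervalIntegrable _ _)]
  congr 1
  simp_rw [← flow_add_apply]
  rw [intervalIntegral.integral_comp_add_right
    (fun s => inputAdjoint q G (flow J s v) ⬝ᵥ inputAdjoint q G (flow J s v))]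
  simp [add_comm]

/-- Since `e^{tJ}` stays bounded in both time directions, every unit time interval contributes at
least a fixed amount to the Gramian, which therefore grows linearly in time. -/
theorem exists_gramian_lower_bound [FiniteDimensional ℝ E] (hpos : ∀ x, x ≠ 0 → 0 < q x x)
    (hskew : ∀ x y, q (J x) y = -q x (J y))
    (hobs : ∀ y, (∀ (k : ℕ) u, q (G u) ((J ^ k) y) = 0) → y = 0) :
    ∃ c : ℝ, 0 < c ∧ ∀ (k : ℕ) v, k * c * ‖v‖ ^ 2 ≤ q (gramian q J G k v) v := by
  obtain ⟨C, hC, hflow⟩ := exists_norm_flow_le_of_skew hpos hskew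
  obtain ⟨c, hc, hgram⟩ := exists_coercive_form (q.comp (gramian q J G 1))
    fun v hv => form_gramian_pos hskew hobs hv
  refine ⟨c / C ^ 2, by positivity, fun k v => ?_⟩
  induction k with
  | zero => simp [gramian]
  | succ k ih =>
    rw [form_gramian_succ hskew]
    have h1 : ‖v‖ ≤ C * ‖flow J k v‖ := by
      simpa using hflow (-k) (flow J k v)
    have h2 : c / C ^ 2 * ‖v‖ ^ 2 ≤ q (gramian q J G 1 (flow J k v)) (flow J k v) :=
      calc c / C ^ 2 * ‖v‖ ^ 2 ≤ c / C ^ 2 * (C * ‖flow J k v‖) ^ 2 := by gcongr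
        _ = c * ‖flow J k v‖ ^ 2 := by field_simp
        _ ≤ _ := hgram _
    push_cast
    linarith

/-- Variation of constants for the control `u(s) = G* e^{sJ} v`: the solution starting at `a` is
`e^{tJ} (a + W_t v)`, where `W_t` is the Gramian. -/
theorem steers_of_gramian (T : ℝ) (a v : E) :
    Steers (J : E →ₗ[ℝ] E) (G : (Fin m → ℝ) →ₗ[ℝ] E) T
      (fun s => inputAdjoint q G (flow J s v)) a (flow J T (a + gramian q J G T v)) := by
  have hgc : Continuous fun s => gramianIntegrand q J G s v :=
    continuous_gramianIntegrand.clm_apply continuous_const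
  have hd : ∀ t, HasDerivAt (fun t => flow J t (a + gramian q J G t v))
      (J (flow J t (a + gramian q J G t v)) + G (inputAdjoint q G (flow J t v))) t := by
    intro t
    have h1 : HasDerivAt (fun t => a + gramian q J G t v) (gramianIntegrand q J G t v) t := by
      simp_rw [gramian_apply]
      exact (intervalIntegral.integral_hasDerivAt_right (hgc.intervalIntegrable 0 t)
        (hgc.stronglyMeasurableAtFilter _ _) hgc.continuousAt).const_add a
    have h2 := (hasDerivAt_flow J t).clm_apply h1
    simpa [gramianIntegrand] using h2
  refine ⟨fun t => flow J t (a + gramian q J G t v), ⟨?_, ae_of_all _ hd⟩, by simp [gramian], rfl⟩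
  have hcd : ContDiff ℝ 1 fun t => flow J t (a + gramian q J G t v) := by
    rw [contDiff_one_iff_deriv]
    refine ⟨fun t => (hd t).differentiableAt, ?_⟩
    rw [show deriv (fun t => flow J t (a + gramian q J G t v)) = _ from
      funext fun t => (hd t).deriv]
    refine (J.continuous.comp (continuous_iff_continuousAt.2 fun t => (hd t).continuousAt)).add
      (G.continuous.comp ((inputAdjoint q G).continuous.comp (continuous_flow_apply J v)))
  exact hcd.contDiffOn.absolutelyContinuousOnInterval

/-- A controllable conservative system (written as observability of the adjoint pair) can be
steered from any state to any other by arbitrarily small controls, given enough time. -/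
theorem exists_steers_of_skew [FiniteDimensional ℝ E] (hpos : ∀ x, x ≠ 0 → 0 < q x x)
    (hskew : ∀ x y, q (J x) y = -q x (J y))
    (hobs : ∀ y, (∀ (k : ℕ) u, q (G u) ((J ^ k) y) = 0) → y = 0)
    {U : Set (Fin m → ℝ)} (hU : U ∈ 𝓝 0) (a b : E) :
    ∃ T : ℝ, 0 < T ∧ ∃ u : ℝ → Fin m → ℝ, IsAdmissibleControl U T u ∧
      Steers (J : E →ₗ[ℝ] E) (G : (Fin m → ℝ) →ₗ[ℝ] E) T u a b := by
  obtain ⟨ε, hε, hball⟩ := Metric.mem_nhds_iff.1 hU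
  obtain ⟨C, hC, hflow⟩ := exists_norm_flow_le_of_skew hpos hskew
  obtain ⟨c, hc, hgram⟩ := exists_gramian_lower_bound hpos hskew hobs
  set H := inputAdjoint q G with hH
  set M := ‖H‖ * C * (‖q‖ * (C * ‖b‖ + ‖a‖)) / c with hM
  obtain ⟨k, hk⟩ := exists_nat_gt (M / ε)
  have hM0 : 0 ≤ M := by positivity
  have hk0 : (0 : ℝ) < k := lt_of_le_of_lt (by positivity) hk
  have hinj : Function.Injective (gramian q J G k) := by
    refine (injective_iff_map_eq_zero _).2 fun v hv => ?_
    have h := hgram k v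
    rw [hv, map_zero, zero_apply] at h
    by_contra hne
    have : 0 < ‖v‖ := norm_pos_iff.2 hne
    have : 0 < k * c * ‖v‖ ^ 2 := by positivity
    linarith
  obtain ⟨v, hv⟩ := (LinearMap.injective_iff_surjective
    (f := (gramian q J G k : E →ₗ[ℝ] E))).1 hinj (flow J (-k) b - a)
  replace hv : gramian q J G k v = flow J (-k) b - a := hv
  have hy : ‖flow J (-k) b - a‖ ≤ C * ‖b‖ + ‖a‖ :=
    (norm_sub_le _ _).trans (add_le_add_left (hflow _ _) _)
  -- The lower bound on the Gramian makes its inverse small, of size `O(1 / k)`.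
  have hvn : k * c * ‖v‖ ≤ ‖q‖ * (C * ‖b‖ + ‖a‖) := by
    rcases eq_or_ne v 0 with rfl | hne
    · simp only [norm_zero, mul_zero]; positivity
    · refine le_of_mul_le_mul_right ?_ (norm_pos_iff.2 hne)
      calc k * c * ‖v‖ * ‖v‖ = k * c * ‖v‖ ^ 2 := by ring
        _ ≤ q (gramian q J G k v) v := hgram k v
        _ ≤ ‖q‖ * ‖flow J (-k) b - a‖ * ‖v‖ := by rw [← hv]; exact form_apply_le _ _ _
        _ ≤ ‖q‖ * (C * ‖b‖ + ‖a‖) * ‖v‖ := by gcongr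
  have hsmall : ∀ s, H (flow J s v) ∈ U := fun s => by
    refine hball (mem_ball_zero_iff.2 ?_)
    calc ‖H (flow J s v)‖ ≤ ‖H‖ * (C * ‖v‖) :=
          (H.le_opNorm _).trans (by gcongr; exact hflow s v)
      _ = ‖H‖ * C * (k * c * ‖v‖) / c / k := by field_simp
      _ ≤ ‖H‖ * C * (‖q‖ * (C * ‖b‖ + ‖a‖)) / c / k := by gcongr
      _ = M / k := by rw [hM]
      _ < ε := by rwa [div_lt_iff₀ hk0, ← div_lt_iff₀' hε]
  refine ⟨k, hk0, fun s => H (flow J s v), ⟨?_, ae_of_all _ hsmall⟩, ?_⟩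
  · have hcont : Continuous fun s => H (flow J s v) :=
      H.continuous.comp (continuous_flow_apply J v)
    exact hcont.integrableOn_Icc.mono_set Ioo_subset_Icc_self
  · have h := steers_of_gramian (q := q) (J := J) (G := G) k a v
    rwa [hv, add_sub_cancel, flow_apply_flow_neg] at h

end Skew

/-! ### Boundedness of dissipative systems -/

section Dissipative

/-- A Grönwall bound for absolutely continuous functions: if `V' ≤ ε (C - V)` almost everywhere,
then `e^{εt} (V - C)` does not increase. -/
theorem le_of_ae_hasDerivAt_le {V V' : ℝ → ℝ} {T ε C : ℝ} (hT : 0 ≤ T) (hε : 0 ≤ ε)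
    (hV : AbsolutelyContinuousOnInterval V 0 T)
    (hd : ∀ᵐ t ∂(volume.restrict (Ioo 0 T)), HasDerivAt V (V' t) t ∧ V' t ≤ ε * (C - V t)) :
    V T ≤ C + |V 0 - C| := by
  have hexp : AbsolutelyContinuousOnInterval (fun t => Real.exp (ε * t)) 0 T := by
    refine ContDiffOn.absolutelyContinuousOnInterval ?_
    fun_prop
  have hVC : AbsolutelyContinuousOnInterval (fun t => V t - C) 0 T := by
    refine hV.fun_sub (ContDiffOn.absolutelyContinuousOnInterval ?_)
    fun_prop
  have hac := hexp.fun_mul hVC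
  have hint := hac.integral_deriv_eq_sub
  rw [intervalIntegral.integral_of_le hT, integral_Ioc_eq_integral_Ioo] at hint
  have hle : ∫ t in Ioo 0 T, deriv (fun t => Real.exp (ε * t) * (V t - C)) t ≤ 0 := by
    refine integral_nonpos_of_ae ?_
    filter_upwards [hd] with t ht
    have he : HasDerivAt (fun t => Real.exp (ε * t)) (Real.exp (ε * t) * (ε * 1)) t :=
      ((hasDerivAt_id t).const_mul ε).exp
    have hprod : HasDerivAt (fun t => Real.exp (ε * t) * (V t - C)) _ t :=
      he.mul (ht.1.sub_const C)
    rw [hprod.deriv]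
    have h := mul_nonneg (Real.exp_pos (ε * t)).le (sub_nonneg.2 ht.2)
    simp only [Pi.zero_apply]
    linarith
  rw [hint] at hle
  simp only [mul_zero, Real.exp_zero, one_mul] at hle
  have h1 : 1 ≤ Real.exp (ε * T) := Real.one_le_exp (by positivity)
  have h2 := le_abs_self (V 0 - C)
  have h3 := abs_nonneg (V 0 - C)
  rcases le_total (V T) C with h | h
  · linarith
  · nlinarith

variable {E : Type*} [NormedAddCommGroup E] [NormedSpace ℝ E] [CompleteSpace E]

theorem flow_apply_comm (F : E →L[ℝ] E) (t : ℝ) (x : E) : flow F t (F x) = F (flow F t x) := by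
  have h1 : HasDerivAt (flow F) (flow F t * F) t := hasDerivAt_exp_smul_const F t
  exact congrArg (fun L : E →L[ℝ] E => L x) (h1.unique (hasDerivAt_flow F t))

/-- The form `∫₀¹ q (e^{sF} x) (e^{sF} y) ds`: the form `q` averaged along the flow of `F`. -/
noncomputable def averagedForm (q : E →L[ℝ] E →L[ℝ] ℝ) (F : E →L[ℝ] E) : E →L[ℝ] E →L[ℝ] ℝ :=
  ∫ s in (0 : ℝ)..1, q.bilinearComp (flow F s) (flow F s)

variable {q : E →L[ℝ] E →L[ℝ] ℝ} {F : E →L[ℝ] E}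

theorem averagedForm_apply (x y : E) :
    averagedForm q F x y = ∫ s in (0 : ℝ)..1, q (flow F s x) (flow F s y) := by
  have hc : Continuous fun s => q.bilinearComp (flow F s) (flow F s) := by
    have hflip : ∀ {g : ℝ → E →L[ℝ] E →L[ℝ] ℝ}, Continuous g → Continuous fun s => (g s).flip :=
      fun hg => (ContinuousLinearMap.flipₗᵢ ℝ E E ℝ).continuous.comp hg
    exact hflip ((hflip (continuous_const.clm_comp (continuous_flow F))).clm_comp
      (continuous_flow F))
  have hc' : Continuous fun s => q.bilinearComp (flow F s) (flow F s) x :=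
    hc.clm_apply continuous_const
  rw [averagedForm, ContinuousLinearMap.intervalIntegral_apply (hc.intervalIntegrable 0 1),
    ContinuousLinearMap.intervalIntegral_apply (hc'.intervalIntegrable 0 1)]
  rfl

theorem averagedForm_pos (hpos : ∀ x, x ≠ 0 → 0 < q x x) {x : E} (hx : x ≠ 0) :
    0 < averagedForm q F x x := by
  have h : ∀ s, 0 < q (flow F s x) (flow F s x) := fun s => by
    refine hpos _ fun h0 => hx ?_
    rw [← flow_neg_apply_flow F s x, h0, map_zero]
  rw [averagedForm_apply]
  have hf := continuous_flow_apply F x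
  have hc : Continuous fun s => q (flow F s x) (flow F s x) := by fun_prop
  exact intervalIntegral.intervalIntegral_pos_of_pos (hc.intervalIntegrable 0 1) h one_pos

/-- The Lyapunov identity: differentiating the averaged form along the flow leaves only the boundary
terms of the average. -/
theorem averagedForm_lyapunov (x : E) :
    averagedForm q F (F x) x + averagedForm q F x (F x) = q (flow F 1 x) (flow F 1 x) - q x x := by
  have hf := continuous_flow_apply F x
  have hf' := continuous_flow_apply F (F x)
  have hc1 : Continuous fun s => q (flow F s (F x)) (flow F s x) := by fun_prop
  have hc2 : Continuous fun s => q (flow F s x) (flow F s (F x)) := by fun_prop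
  rw [averagedForm_apply, averagedForm_apply, ← intervalIntegral.integral_add
    (hc1.intervalIntegrable 0 1) (hc2.intervalIntegrable 0 1)]
  have h := intervalIntegral.integral_eq_sub_of_hasDerivAt (a := 0) (b := 1)
    (f := fun s => q (flow F s x) (flow F s x))
    (f' := fun s => q (flow F s (F x)) (flow F s x) + q (flow F s x) (flow F s (F x)))
    (fun s _ => by
      rw [flow_apply_comm]
      exact hasDerivAt_form q (hasDerivAt_flow_apply F x s) (hasDerivAt_flow_apply F x s))
    ((hc1.add hc2).intervalIntegrable 0 1)
  simpa using h

/-- If the energy `q` never increases and the dissipation is observable, then the energy strictly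
decreases over unit time. -/
theorem form_flow_one_lt {G : Type*} [NormedAddCommGroup G] [NormedSpace ℝ G] (D : E →L[ℝ] G)
    (hdiss : ∀ x, q (F x) x + q x (F x) ≤ 0) (hD : ∀ x, q (F x) x + q x (F x) = 0 → D x = 0)
    (hobs : ∀ y, (∀ k : ℕ, D ((F ^ k) y) = 0) → y = 0) {x : E} (hx : x ≠ 0) :
    q (flow F 1 x) (flow F 1 x) < q x x := by
  by_contra! hge
  have hd : ∀ s, HasDerivAt (fun s => q (flow F s x) (flow F s x))
      (q (F (flow F s x)) (flow F s x) + q (flow F s x) (F (flow F s x))) s := fun s =>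
    hasDerivAt_form q (hasDerivAt_flow_apply F x s) (hasDerivAt_flow_apply F x s)
  have hanti : Antitone fun s => q (flow F s x) (flow F s x) :=
    antitone_of_deriv_nonpos (fun s => (hd s).differentiableAt)
      fun s => (hd s).deriv ▸ hdiss _
  refine hx (eq_zero_of_flow_output_eq_zero F D hobs fun t ht => hD _ ?_)
  have hconst : ∀ s ∈ Ioo (0 : ℝ) 1, q (flow F s x) (flow F s x) = q x x := fun s hs => by
    have h0 := hanti hs.1.le
    have h1 := hanti hs.2.le
    simp only [flow_zero, one_apply_eq_self] at h0 h1
    exact le_antisymm h0 (hge.trans h1)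
  refine (hd t).unique ((hasDerivAt_const t (q x x)).congr_of_eventuallyEq ?_)
  filter_upwards [isOpen_Ioo.mem_nhds ht] with s hs using hconst s hs

/-- A dissipative system whose dissipation is observable is bounded-input bounded-state stable. The
averaged form is a strict Lyapunov function, although `q` itself need not be one. -/
theorem isBounded_reachableSet_of_dissipative [FiniteDimensional ℝ E] {G : Type*}
    [NormedAddCommGroup G] [NormedSpace ℝ G] (D : E →L[ℝ] G) (hpos : ∀ x, x ≠ 0 → 0 < q x x)
    (hdiss : ∀ x, q (F x) x + q x (F x) ≤ 0) (hD : ∀ x, q (F x) x + q x (F x) = 0 → D x = 0)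
    (hobs : ∀ y, (∀ k : ℕ, D ((F ^ k) y) = 0) → y = 0) {m : ℕ} (B : (Fin m → ℝ) →L[ℝ] E)
    {U : Set (Fin m → ℝ)} (hU : Bornology.IsBounded U) (a : E) :
    Bornology.IsBounded (reachableSet (F : E →ₗ[ℝ] E) (B : (Fin m → ℝ) →ₗ[ℝ] E) U a) := by
  set p := averagedForm q F with hp
  obtain ⟨c, hc, hpc⟩ := exists_coercive_form p fun x hx => averagedForm_pos hpos hx
  obtain ⟨d, hd, hpd⟩ := exists_coercive_form (-(p.comp F + p.flip.comp F)) fun x hx => by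
    have h1 := averagedForm_lyapunov (q := q) (F := F) x
    have h2 := form_flow_one_lt D hdiss hD hobs hx
    simp only [neg_apply, add_apply, ContinuousLinearMap.comp_apply,
      ContinuousLinearMap.flip_apply]
    linarith
  have hlyap : ∀ x, p (F x) x + p x (F x) ≤ -(d * ‖x‖ ^ 2) := fun x => by
    have h := hpd x
    simp only [neg_apply, add_apply, ContinuousLinearMap.comp_apply,
      ContinuousLinearMap.flip_apply] at h
    linarith
  obtain ⟨K, hK0, hK⟩ := hU.exists_pos_norm_le
  set P := ‖p‖ + 1 with hP
  have hP0 : 0 < P := by positivity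
  set M := ‖p‖ * ‖B‖ * K with hM
  have hM0 : 0 ≤ M := by positivity
  -- Completing the square gives `V' ≤ -d ‖x‖² + 2 M ‖x‖ ≤ -(d / 2) ‖x‖² + 2 M² / d`.
  set ε := d / (2 * P) with hε
  have hε0 : 0 < ε := by positivity
  set C := 2 * M ^ 2 / d / ε with hC
  have hineq : ∀ x u, u ∈ U → p (F x + B u) x + p x (F x + B u) ≤ ε * (C - p x x) := by
    intro x u hu
    have hBu : ‖B u‖ ≤ ‖B‖ * K := (B.le_opNorm u).trans (by gcongr; exact hK u hu)
    have h1 : p (B u) x ≤ M * ‖x‖ := (form_apply_le p _ _).trans <| by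
      rw [hM, mul_assoc ‖p‖ ‖B‖ K]; gcongr
    have h2 : p x (B u) ≤ M * ‖x‖ := (form_apply_le p _ _).trans <| by
      rw [hM, mul_assoc ‖p‖ ‖B‖ K, mul_right_comm]; gcongr
    have h3 : p x x ≤ P * ‖x‖ ^ 2 := (form_apply_le p x x).trans <| by
      nlinarith [sq_nonneg ‖x‖]
    have h4 : ε * p x x ≤ d / 2 * ‖x‖ ^ 2 := by
      calc ε * p x x ≤ ε * (P * ‖x‖ ^ 2) := by gcongr
        _ = d / 2 * ‖x‖ ^ 2 := by rw [hε]; field_simp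
    have h5 : ε * C = 2 * M ^ 2 / d := by rw [hC]; field_simp
    have h6 : 2 * M * ‖x‖ ≤ d / 2 * ‖x‖ ^ 2 + 2 * M ^ 2 / d := by
      have h : 0 ≤ (d * ‖x‖ - 2 * M) ^ 2 / (2 * d) := by positivity
      have h' : (d * ‖x‖ - 2 * M) ^ 2 / (2 * d)
          = d / 2 * ‖x‖ ^ 2 - 2 * M * ‖x‖ + 2 * M ^ 2 / d := by field_simp; ring
      linarith
    have h7 := hlyap x
    simp only [map_add, add_apply]
    linarith
  refine isBounded_iff_forall_norm_le.2 ⟨Real.sqrt ((C + |p a a - C|) / c), ?_⟩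
  rintro b ⟨T, hT, u, ⟨-, hu⟩, x, ⟨hxac, hx⟩, rfl, rfl⟩
  refine Real.le_sqrt_of_sq_le ?_
  rw [le_div_iff₀ hc, mul_comm]
  refine (hpc _).trans (le_of_ae_hasDerivAt_le hT hε0.le (V := fun t => p (x t) (x t))
    (V' := fun t => p (F (x t) + B (u t)) (x t) + p (x t) (F (x t) + B (u t)))
    (hxac.form_self p) ?_)
  filter_upwards [hx, hu] with t hxt hut
  exact ⟨hasDerivAt_form p hxt hxt, hineq _ _ hut⟩

end Dissipative

/-! ### Real and imaginary parts of eigenvectors -/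

section Eigenvectors

variable {n : ℕ} (A : Matrix (Fin n) (Fin n) ℝ)

theorem re_map_ofReal_mulVec (z : Fin n → ℂ) :
    (fun i => ((A.map Complex.ofReal).mulVec z i).re) = A.mulVec fun i => (z i).re := by
  ext i
  simp [Matrix.mulVec, dotProduct]

theorem im_map_ofReal_mulVec (z : Fin n → ℂ) :
    (fun i => ((A.map Complex.ofReal).mulVec z i).im) = A.mulVec fun i => (z i).im := by
  ext i
  simp [Matrix.mulVec, dotProduct]

theorem mulVec_re_of_eigenvector {z : Fin n → ℂ} {μ : ℂ}
    (hz : (A.map Complex.ofReal).mulVec z = μ • z) :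
    (A.mulVec fun i => (z i).re) = μ.re • (fun i => (z i).re) - μ.im • fun i => (z i).im := by
  rw [← re_map_ofReal_mulVec, hz]
  ext i
  simp

theorem mulVec_im_of_eigenvector {z : Fin n → ℂ} {μ : ℂ}
    (hz : (A.map Complex.ofReal).mulVec z = μ • z) :
    (A.mulVec fun i => (z i).im) = μ.re • (fun i => (z i).im) + μ.im • fun i => (z i).re := by
  rw [← im_map_ofReal_mulVec, hz]
  ext i
  simp

/-- A nonzero real invariant subspace contains the real and imaginary parts of some complex
eigenvector: the restriction to its complexification has an eigenvalue. -/
theorem exists_eigenvector_of_invariant (N : Submodule ℝ (Fin n → ℝ)) (hN : N ≠ ⊥)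
    (hinv : ∀ x ∈ N, A.mulVec x ∈ N) :
    ∃ (z : Fin n → ℂ) (μ : ℂ), z ≠ 0 ∧ (A.map Complex.ofReal).mulVec z = μ • z ∧
      (fun i => (z i).re) ∈ N ∧ (fun i => (z i).im) ∈ N := by
  let NC : Submodule ℂ (Fin n → ℂ) :=
    { carrier := {z | (fun i => (z i).re) ∈ N ∧ (fun i => (z i).im) ∈ N}
      add_mem' := fun {z w} hz hw => ⟨N.add_mem hz.1 hw.1, N.add_mem hz.2 hw.2⟩
      zero_mem' := ⟨N.zero_mem, N.zero_mem⟩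
      smul_mem' := fun c z hz => by
        constructor
        · convert! N.sub_mem (N.smul_mem c.re hz.1) (N.smul_mem c.im hz.2) using 1
        · convert! N.add_mem (N.smul_mem c.re hz.2) (N.smul_mem c.im hz.1) using 1 }
  have hmap : ∀ z ∈ NC, (A.map Complex.ofReal).mulVecLin z ∈ NC := fun z hz => by
    refine ⟨?_, ?_⟩
    · simpa only [Matrix.mulVecLin_apply, re_map_ofReal_mulVec] using hinv _ hz.1
    · simpa only [Matrix.mulVecLin_apply, im_map_ofReal_mulVec] using hinv _ hz.2
  obtain ⟨x, hxN, hx0⟩ := N.ne_bot_iff.1 hN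
  have : Nontrivial NC := by
    refine ⟨⟨⟨fun i => (x i : ℂ), ?_⟩, 0, fun h => hx0 ?_⟩⟩
    · refine ⟨by simpa using hxN, ?_⟩
      exact N.zero_mem
    · ext i
      have h' := congrFun (congrArg Subtype.val h) i
      simpa using h'
  obtain ⟨μ, hμ⟩ := Module.End.exists_eigenvalue ((A.map Complex.ofReal).mulVecLin.restrict hmap)
  obtain ⟨z, hz⟩ := hμ.exists_hasEigenvector
  refine ⟨z, μ, fun h => hz.2 (Subtype.ext h), ?_, z.2.1, z.2.2⟩
  exact congrArg Subtype.val hz.apply_eq_smul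

end Eigenvectors

/-! ### The conservative and dissipative subspaces -/

namespace PHSystem

variable {n m : ℕ} (S : PHSystem n m)

/-- The energy inner product `⟨Q x, y⟩` as a continuous bilinear form. -/
noncomputable def energyForm : (Fin n → ℝ) →L[ℝ] (Fin n → ℝ) →L[ℝ] ℝ :=
  LinearMap.toContinuousBilinearMap (Matrix.toBilin' S.Q)

theorem energyForm_apply (x y : Fin n → ℝ) : S.energyForm x y = x ⬝ᵥ S.Q.mulVec y := by
  simp [energyForm, Matrix.toBilin'_apply']

theorem Q_transpose : S.Q.transpose = S.Q := by
  simpa [Matrix.IsHermitian, Matrix.conjTranspose_eq_transpose_of_trivial]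
    using S.Q_posDef.isHermitian

theorem R_transpose : S.R.transpose = S.R := by
  simpa [Matrix.IsHermitian, Matrix.conjTranspose_eq_transpose_of_trivial]
    using S.R_posSemidef.isHermitian

theorem energyForm_comm (x y : Fin n → ℝ) : S.energyForm x y = S.energyForm y x := by
  rw [energyForm_apply, energyForm_apply, dotProduct_comm y, Matrix.dotProduct_mulVec,
    ← Matrix.mulVec_transpose, Q_transpose]

theorem energyForm_pos {x : Fin n → ℝ} (hx : x ≠ 0) : 0 < S.energyForm x x := by
  rw [energyForm_apply]
  simpa using S.Q_posDef.dotProduct_mulVec_pos hx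

theorem energyForm_J (x y : Fin n → ℝ) :
    S.energyForm ((S.J * S.Q).mulVec x) y = -S.energyForm x ((S.J * S.Q).mulVec y) := by
  rw [S.energyForm_comm x, energyForm_apply, energyForm_apply, ← Matrix.mulVec_mulVec,
    ← Matrix.mulVec_mulVec, dotProduct_comm, Matrix.dotProduct_mulVec, ← Matrix.mulVec_transpose,
    S.J_skew, Matrix.neg_mulVec, neg_dotProduct]

theorem energyForm_R (x y : Fin n → ℝ) :
    S.energyForm ((S.R * S.Q).mulVec x) y = S.energyForm x ((S.R * S.Q).mulVec y) := by
  rw [S.energyForm_comm x, energyForm_apply, energyForm_apply, ← Matrix.mulVec_mulVec,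
    ← Matrix.mulVec_mulVec, dotProduct_comm, Matrix.dotProduct_mulVec, ← Matrix.mulVec_transpose,
    S.R_transpose]

theorem A_mulVec (x : Fin n → ℝ) :
    S.A.mulVec x = (S.J * S.Q).mulVec x - (S.R * S.Q).mulVec x := by
  rw [A, Matrix.sub_mul, Matrix.sub_mulVec]

theorem energyForm_R_self_nonneg (x : Fin n → ℝ) :
    0 ≤ S.energyForm ((S.R * S.Q).mulVec x) x := by
  rw [energyForm_apply, dotProduct_comm, ← Matrix.mulVec_mulVec]
  simpa using S.R_posSemidef.dotProduct_mulVec_nonneg (S.Q.mulVec x)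

theorem RQ_mulVec_eq_zero {x : Fin n → ℝ} (hx : S.energyForm ((S.R * S.Q).mulVec x) x = 0) :
    (S.R * S.Q).mulVec x = 0 := by
  rw [energyForm_apply, dotProduct_comm, ← Matrix.mulVec_mulVec] at hx
  rw [← Matrix.mulVec_mulVec]
  exact (S.R_posSemidef.dotProduct_mulVec_zero_iff _).1 (by simpa using hx)

/-- The energy balance: the skew part `J` conserves energy, so only `R` contributes. -/
theorem energyForm_A_self (x : Fin n → ℝ) :
    S.energyForm (S.A.mulVec x) x = -S.energyForm ((S.R * S.Q).mulVec x) x := by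
  have h1 := S.energyForm_J x x
  rw [S.energyForm_comm x] at h1
  rw [A_mulVec, map_sub, sub_apply]
  linarith

/-- The energy balance of a complex eigenvector, written for its real and imaginary parts. -/
theorem eigenvalue_re_mul_energy {z : Fin n → ℂ} {μ : ℂ}
    (hz : (S.A.map Complex.ofReal).mulVec z = μ • z) :
    μ.re * (S.energyForm (fun i => (z i).re) (fun i => (z i).re) +
        S.energyForm (fun i => (z i).im) (fun i => (z i).im)) =
      -(S.energyForm ((S.R * S.Q).mulVec fun i => (z i).re) (fun i => (z i).re) +
        S.energyForm ((S.R * S.Q).mulVec fun i => (z i).im) (fun i => (z i).im)) := by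
  have h1 := S.energyForm_A_self fun i => (z i).re
  have h2 := S.energyForm_A_self fun i => (z i).im
  rw [mulVec_re_of_eigenvector S.A hz] at h1
  rw [mulVec_im_of_eigenvector S.A hz] at h2
  have h3 := S.energyForm_comm (fun i => (z i).re) (fun i => (z i).im)
  simp only [map_sub, map_add, map_smul, sub_apply, add_apply, smul_apply, smul_eq_mul] at h1 h2
  rw [h3] at h2
  linarith

theorem RQ_mulVec_eq_zero_of_eigenvector {z : Fin n → ℂ} {μ : ℂ} (hμ : μ.re = 0)
    (hz : (S.A.map Complex.ofReal).mulVec z = μ • z) :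
    ((S.R * S.Q).mulVec fun i => (z i).re) = 0 ∧ ((S.R * S.Q).mulVec fun i => (z i).im) = 0 := by
  have h := S.eigenvalue_re_mul_energy hz
  rw [hμ, zero_mul] at h
  have h1 := S.energyForm_R_self_nonneg fun i => (z i).re
  have h2 := S.energyForm_R_self_nonneg fun i => (z i).im
  exact ⟨S.RQ_mulVec_eq_zero (by linarith), S.RQ_mulVec_eq_zero (by linarith)⟩

theorem mem_M₁_of_eigenvector {z : Fin n → ℂ} {μ : ℂ} (hμ : μ.re = 0)
    (hz : (S.A.map Complex.ofReal).mulVec z = μ • z) :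
    (fun i => (z i).re) ∈ S.M₁ ∧ (fun i => (z i).im) ∈ S.M₁ := by
  rcases eq_or_ne z 0 with rfl | hz0
  · exact ⟨S.M₁.zero_mem, S.M₁.zero_mem⟩
  have hμ' : (μ.im : ℂ) * Complex.I = μ := by
    apply Complex.ext <;> simp [hμ]
  have hspec : ((μ.im : ℝ) : ℂ) * Complex.I ∈ spectrum ℂ (S.A.map Complex.ofReal) := by
    rw [hμ', ← Matrix.spectrum_toLin']
    exact (Module.End.hasEigenvalue_of_hasEigenvector
      ⟨Module.End.mem_eigenspace_iff.2 (by simpa using hz), hz0⟩).mem_spectrum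
  have hle : realEigenspan S.A μ ≤ S.M₁ := by
    have h := le_iSup₂ (f := fun (α : ℝ) (_ : α ∈ {α : ℝ | (α : ℂ) * Complex.I ∈
      spectrum ℂ (S.A.map Complex.ofReal)}) => realEigenspan S.A ((α : ℂ) * Complex.I))
      μ.im hspec
    rwa [hμ'] at h
  exact ⟨hle (Submodule.subset_span ⟨z, hz, Or.inl rfl⟩),
    hle (Submodule.subset_span ⟨z, hz, Or.inr rfl⟩)⟩

/-- `M₁` is the smallest subspace containing the real and imaginary parts of all eigenvectors for
imaginary eigenvalues. -/
theorem M₁_le_of_eigenvector (N : Submodule ℝ (Fin n → ℝ))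
    (hN : ∀ (z : Fin n → ℂ) (μ : ℂ), μ.re = 0 → (S.A.map Complex.ofReal).mulVec z = μ • z →
      (fun i => (z i).re) ∈ N ∧ (fun i => (z i).im) ∈ N) : S.M₁ ≤ N := by
  refine iSup₂_le fun α _ => Submodule.span_le.2 ?_
  rintro v ⟨z, hz, rfl | rfl⟩
  · exact (hN z _ (by simp) hz).1
  · exact (hN z _ (by simp) hz).2

theorem RQ_mulVec_of_mem_M₁ {x : Fin n → ℝ} (hx : x ∈ S.M₁) : (S.R * S.Q).mulVec x = 0 := by
  have h : S.M₁ ≤ LinearMap.ker (S.R * S.Q).mulVecLin :=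
    S.M₁_le_of_eigenvector _ fun z μ hμ hz => by
      simpa using S.RQ_mulVec_eq_zero_of_eigenvector hμ hz
  simpa using h hx

theorem A_mulVec_mem_M₁ {x : Fin n → ℝ} (hx : x ∈ S.M₁) : S.A.mulVec x ∈ S.M₁ := by
  have h : S.M₁ ≤ S.M₁.comap S.A.mulVecLin :=
    S.M₁_le_of_eigenvector _ fun z μ hμ hz => by
      obtain ⟨h1, h2⟩ := S.mem_M₁_of_eigenvector hμ hz
      simp only [Submodule.mem_comap, Matrix.mulVecLin_apply,
        mulVec_re_of_eigenvector S.A hz, mulVec_im_of_eigenvector S.A hz]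
      exact ⟨S.M₁.sub_mem (S.M₁.smul_mem _ h1) (S.M₁.smul_mem _ h2),
        S.M₁.add_mem (S.M₁.smul_mem _ h2) (S.M₁.smul_mem _ h1)⟩
  exact h hx

theorem A_mulVec_of_mem_M₁ {x : Fin n → ℝ} (hx : x ∈ S.M₁) :
    S.A.mulVec x = (S.J * S.Q).mulVec x := by
  rw [A_mulVec, S.RQ_mulVec_of_mem_M₁ hx, sub_zero]

theorem mem_M₂_iff {y : Fin n → ℝ} : y ∈ S.M₂ ↔ ∀ x ∈ S.M₁, S.energyForm x y = 0 := Iff.rfl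

theorem RQ_mulVec_mem_M₂ (y : Fin n → ℝ) : (S.R * S.Q).mulVec y ∈ S.M₂ := by
  rw [mem_M₂_iff]
  intro x hx
  rw [← energyForm_R, S.RQ_mulVec_of_mem_M₁ hx, map_zero, zero_apply]

theorem JQ_mulVec_mem_M₂ {y : Fin n → ℝ} (hy : y ∈ S.M₂) : (S.J * S.Q).mulVec y ∈ S.M₂ := by
  rw [mem_M₂_iff] at hy ⊢
  intro x hx
  rw [← neg_eq_zero, ← energyForm_J, ← S.A_mulVec_of_mem_M₁ hx]
  exact hy _ (S.A_mulVec_mem_M₁ hx)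

theorem A_mulVec_mem_M₂ {y : Fin n → ℝ} (hy : y ∈ S.M₂) : S.A.mulVec y ∈ S.M₂ := by
  rw [A_mulVec]
  exact S.M₂.sub_mem (S.JQ_mulVec_mem_M₂ hy) (S.RQ_mulVec_mem_M₂ y)

theorem coe_J₁_apply (x : S.M₁) : (S.J₁ x : Fin n → ℝ) = S.A.mulVec x := by
  have hmem : (S.J * S.Q).mulVec x ∈ S.M₁ := by
    rw [← S.A_mulVec_of_mem_M₁ x.2]
    exact S.A_mulVec_mem_M₁ x.2
  have h := Submodule.projectionOnto_apply_left S.isCompl ⟨_, hmem⟩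
  rw [S.A_mulVec_of_mem_M₁ x.2]
  exact congrArg Subtype.val h

theorem coe_J₂_sub_R₂_apply (x : S.M₂) : ((S.J₂ - S.R₂) x : Fin n → ℝ) = S.A.mulVec x := by
  have h1 := Submodule.projectionOnto_apply_left S.isCompl.symm ⟨_, S.JQ_mulVec_mem_M₂ x.2⟩
  have h2 := Submodule.projectionOnto_apply_left S.isCompl.symm ⟨_, S.RQ_mulVec_mem_M₂ x⟩
  rw [A_mulVec]
  exact congrArg₂ (· - ·) (congrArg Subtype.val h1) (congrArg Subtype.val h2)

/-- `P₁` is the orthogonal projection for the energy form. -/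
theorem energyForm_P₁ (w : Fin n → ℝ) (y : S.M₁) :
    S.energyForm (S.P₁ w) y = S.energyForm w y := by
  have hmem : w - S.P₁ w ∈ S.M₂ := by
    rw [← Submodule.projectionOnto_apply_eq_zero_iff S.isCompl, map_sub]
    have h := Submodule.projectionOnto_apply_left S.isCompl (S.P₁ w)
    rw [h]
    exact sub_self _
  have h := S.mem_M₂_iff.1 hmem y y.2
  rw [map_sub, sub_eq_zero] at h
  rw [S.energyForm_comm, ← h, S.energyForm_comm]

/-- On `M₁` the adjoint of `A` for the energy form is `-A`. -/
theorem energyForm_A_pow_of_mem_M₁ (k : ℕ) (w : Fin n → ℝ) {y : Fin n → ℝ} (hy : y ∈ S.M₁) :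
    S.energyForm ((S.A ^ k).mulVec w) y = (-1) ^ k * S.energyForm w ((S.A ^ k).mulVec y) := by
  have hadj : ∀ w, ∀ y ∈ S.M₁, S.energyForm (S.A.mulVec w) y = -S.energyForm w (S.A.mulVec y) := by
    intro w y hy
    rw [S.A_mulVec_of_mem_M₁ hy, A_mulVec, map_sub, sub_apply, energyForm_J, energyForm_R,
      S.RQ_mulVec_of_mem_M₁ hy, map_zero, sub_zero]
  induction k generalizing y with
  | zero => simp
  | succ k ih =>
    rw [pow_succ', ← Matrix.mulVec_mulVec, hadj _ _ hy, ih (S.A_mulVec_mem_M₁ hy),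
      Matrix.mulVec_mulVec, ← pow_succ, ← pow_succ', pow_succ (-1 : ℝ)]
    ring

/-- The Kalman rank condition in dual form: only `0` is orthogonal to all `A ^ k B u`. -/
theorem eq_zero_of_energyForm_kalman (hS : S.IsControllable) {y : Fin n → ℝ}
    (hy : ∀ (k : ℕ) (u : Fin m → ℝ), S.energyForm ((S.A ^ k).mulVec (S.B.mulVec u)) y = 0) :
    y = 0 := by
  have hsurj : LinearMap.range S.kalmanMatrix.mulVecLin = ⊤ := by
    apply Submodule.eq_top_of_finrank_eq
    have h : S.kalmanMatrix.rank = n := hS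
    rw [Matrix.rank] at h
    simpa using h
  have hle : Submodule.span ℝ (range S.kalmanMatrix.col) ≤
      LinearMap.ker (S.energyForm.flip y : (Fin n → ℝ) →ₗ[ℝ] ℝ) := by
    refine Submodule.span_le.2 ?_
    rintro _ ⟨⟨k, j⟩, rfl⟩
    have hcol : S.kalmanMatrix.col (k, j) =
        (S.A ^ (k : ℕ)).mulVec (S.B.mulVec (Pi.single j 1)) := by
      rw [Matrix.mulVec_mulVec, Matrix.mulVec_single_one]
      rfl
    rw [hcol]
    exact hy k _
  rw [← Matrix.range_mulVecLin, hsurj] at hle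
  by_contra hne
  exact (S.energyForm_pos hne).ne' (hle (Submodule.mem_top (x := y)))

/-- The conservative part is controllable, in the dual form of observability. -/
theorem observable_J₁ (hS : S.IsControllable) (y : S.M₁)
    (hy : ∀ (k : ℕ) u, S.energyForm (S.B₁ u) ((S.J₁ ^ k) y) = 0) : y = 0 := by
  have hpow : ∀ k : ℕ, ((S.J₁ ^ k) y : Fin n → ℝ) = (S.A ^ k).mulVec y := by
    intro k
    induction k with
    | zero => simp
    | succ k ih =>
      rw [pow_succ', Module.End.mul_apply, coe_J₁_apply, ih, Matrix.mulVec_mulVec, ← pow_succ']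
  refine Subtype.ext (S.eq_zero_of_energyForm_kalman hS fun k u => ?_)
  rw [S.energyForm_A_pow_of_mem_M₁ k _ y.2, ← hpow, ← S.energyForm_P₁]
  exact mul_eq_zero_of_right _ (hy k u)

/-- The dissipation is observable on `M₂`: an undissipated invariant subspace would contain the
parts of an eigenvector with purely imaginary eigenvalue, and these belong to `M₁`. -/
theorem observable_R₂ (y : S.M₂)
    (hy : ∀ k : ℕ, (S.R * S.Q).mulVec ((S.J₂ - S.R₂) ^ k <| y) = 0) : y = 0 := by
  have hpow : ∀ k : ℕ, (((S.J₂ - S.R₂) ^ k) y : Fin n → ℝ) = (S.A ^ k).mulVec y := by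
    intro k
    induction k with
    | zero => simp
    | succ k ih =>
      rw [pow_succ', Module.End.mul_apply, coe_J₂_sub_R₂_apply, ih, Matrix.mulVec_mulVec,
        ← pow_succ']
  let N : Submodule ℝ (Fin n → ℝ) :=
    S.M₂ ⊓ ⨅ k : ℕ, LinearMap.ker ((S.R * S.Q).mulVecLin ∘ₗ (S.A ^ k).mulVecLin)
  have hmem : ∀ x, x ∈ N ↔ x ∈ S.M₂ ∧ ∀ k : ℕ, (S.R * S.Q).mulVec ((S.A ^ k).mulVec x) = 0 := by
    intro x
    simp only [N, Submodule.mem_inf, Submodule.mem_iInf, LinearMap.mem_ker,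
      LinearMap.comp_apply, Matrix.mulVecLin_apply]
  have hyN : (y : Fin n → ℝ) ∈ N := (hmem _).2 ⟨y.2, fun k => by rw [← hpow]; exact hy k⟩
  by_contra hne
  have hN : N ≠ ⊥ := N.ne_bot_iff.2 ⟨y, hyN, fun h => hne (Subtype.ext h)⟩
  obtain ⟨z, μ, hz0, hz, hre, him⟩ := exists_eigenvector_of_invariant S.A N hN fun x hx => by
    rw [hmem] at hx ⊢
    refine ⟨S.A_mulVec_mem_M₂ hx.1, fun k => ?_⟩
    rw [Matrix.mulVec_mulVec _ (S.A ^ k), ← pow_succ]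
    exact hx.2 (k + 1)
  rw [hmem] at hre him
  have hkr := hre.2 0
  have hki := him.2 0
  rw [pow_zero, Matrix.one_mulVec] at hkr hki
  have hbal := S.eigenvalue_re_mul_energy hz
  rw [hkr, hki, map_zero, zero_apply, zero_apply, add_zero, neg_zero] at hbal
  have hdisj := Submodule.disjoint_def.1 S.isCompl.disjoint
  have hzero : ∀ x ∈ S.M₁, x ∈ S.M₂ → x = 0 := fun x => hdisj x
  have hμ : μ.re = 0 := by
    rcases mul_eq_zero.1 hbal with h | h
    · exact h
    · exfalso
      have hnn : ∀ x, 0 ≤ S.energyForm x x := fun x => by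
        rcases eq_or_ne x 0 with rfl | hx
        · simp
        · exact (S.energyForm_pos hx).le
      have h1 : (fun i => (z i).re) = 0 := by
        by_contra hx
        linarith [S.energyForm_pos hx, hnn fun i => (z i).im]
      have h2 : (fun i => (z i).im) = 0 := by
        by_contra hx
        linarith [S.energyForm_pos hx, hnn fun i => (z i).re]
      exact hz0 (funext fun i => Complex.ext (congrFun h1 i) (congrFun h2 i))
  obtain ⟨h1, h2⟩ := S.mem_M₁_of_eigenvector hμ hz
  exact hz0 (funext fun i => Complex.ext (congrFun (hzero _ h1 hre.1) i)
    (congrFun (hzero _ h2 him.1) i))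

/-- The energy form restricted to a subspace. -/
noncomputable def energyFormOn (N : Submodule ℝ (Fin n → ℝ)) : N →L[ℝ] N →L[ℝ] ℝ :=
  S.energyForm.bilinearComp N.subtypeL N.subtypeL

theorem energyFormOn_apply (N : Submodule ℝ (Fin n → ℝ)) (x y : N) :
    S.energyFormOn N x y = S.energyForm x y := rfl

theorem energyFormOn_pos (N : Submodule ℝ (Fin n → ℝ)) (x : N) (hx : x ≠ 0) :
    0 < S.energyFormOn N x x :=
  S.energyForm_pos fun h => hx (Subtype.ext h)

end PHSystem

/-! ### Steering on `M₁` and boundedness on `M₂` -/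

theorem toContinuousLinearMap_pow_apply {E : Type*} [NormedAddCommGroup E] [NormedSpace ℝ E]
    [FiniteDimensional ℝ E] (F : E →ₗ[ℝ] E) (k : ℕ) (x : E) :
    (LinearMap.toContinuousLinearMap F ^ k) x = (F ^ k) x := by
  induction k with
  | zero => simp
  | succ k ih =>
    rw [pow_succ', pow_succ', Module.End.mul_apply, ← ih]
    rfl

theorem lemma2 {n m : ℕ} (S : PHSystem n m) (hS : S.IsControllable)
    (U : Set (Fin m → ℝ)) (hU : IsCompact U) (hU0 : (0 : Fin m → ℝ) ∈ interior U) :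
    (∀ x₁₀ x₁ : S.M₁, ∃ T : ℝ, 0 < T ∧ ∃ u : ℝ → Fin m → ℝ,
      IsAdmissibleControl U T u ∧ Steers S.J₁ S.B₁ T u x₁₀ x₁) ∧
    (∀ x₂₀ : S.M₂, Bornology.IsBounded (reachableSet (S.J₂ - S.R₂) S.B₂ U x₂₀)) := by
  have hc₁ : CompleteSpace S.M₁ := FiniteDimensional.complete ℝ S.M₁
  have hc₂ : CompleteSpace S.M₂ := FiniteDimensional.complete ℝ S.M₂
  refine ⟨fun a b => ?_, fun a => ?_⟩
  · refine exists_steers_of_skew (q := S.energyFormOn S.M₁)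
      (J := LinearMap.toContinuousLinearMap S.J₁) (G := LinearMap.toContinuousLinearMap S.B₁)
      (S.energyFormOn_pos S.M₁) (fun x y => ?_) (fun y hy => S.observable_J₁ hS y fun k u => ?_)
      (mem_interior_iff_mem_nhds.1 hU0) a b
    · simp only [S.energyFormOn_apply, LinearMap.coe_toContinuousLinearMap', S.coe_J₁_apply,
        S.A_mulVec_of_mem_M₁ x.2, S.A_mulVec_of_mem_M₁ y.2]
      exact S.energyForm_J x y
    · have h := hy k u
      rwa [toContinuousLinearMap_pow_apply] at h
  · have hbal : ∀ x : S.M₂, S.energyFormOn S.M₂ ((S.J₂ - S.R₂) x) x +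
        S.energyFormOn S.M₂ x ((S.J₂ - S.R₂) x) =
        -(2 * S.energyForm ((S.R * S.Q).mulVec x) x) := fun x => by
      rw [S.energyFormOn_apply, S.energyFormOn_apply, S.energyForm_comm x,
        S.coe_J₂_sub_R₂_apply, S.energyForm_A_self]
      ring
    refine isBounded_reachableSet_of_dissipative (q := S.energyFormOn S.M₂)
      (F := LinearMap.toContinuousLinearMap (S.J₂ - S.R₂))
      (LinearMap.toContinuousLinearMap ((S.R * S.Q).mulVecLin ∘ₗ S.M₂.subtype))
      (S.energyFormOn_pos S.M₂) (fun x => ?_) (fun x hx => ?_)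
      (fun y hy => S.observable_R₂ y fun k => ?_)
      (LinearMap.toContinuousLinearMap S.B₂) hU.isBounded a
    · exact (hbal x).trans_le (by linarith [S.energyForm_R_self_nonneg x])
    · have h := (hbal x).symm.trans hx
      exact S.RQ_mulVec_eq_zero (x := x) (by linarith)
    · have h := hy k
      rwa [toContinuousLinearMap_pow_apply] at h
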